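/- **Setting.** Let $\mathcal X$ be a measurable space, $\mathcal F$ a finite nonempty set of measurable functions $\mathcal X\to\{0,1\}$, and $n,c,t,\omega$ nonnegative integers with $t\ge 1$. A dataset is $D=(X,y)\in\mathcal X^n\times[c]^n$. A decision tree is a binary tree whose internal nodes carry elements of $\mathcal F$, which route points to the left or right child; its size is its total number of nodes. A fixed, arbitrary rule (for instance majority vote, or the Dirichlet posterior predictive distribution) lets each leaf predict a possibly random label whose law depends on the label counts of $D$ at that leaf. $L(T,D)\in[0,1]$ is the expected fraction of the points of $D$ whose label is predicted incorrectly by $T$ (with $L=0$ if $n=0$). **The $(\sigma,\phi)$-Bayesian algorithm family** ($\sigma,\phi>0$). On input $D$: 1. *Prior.* Draw $\mathbf z=(\mathbf z_1,\dots,\mathbf z_{t-1})$ uniformly from $[0,1]^{t-1}$. Start with a single root node and treat the nodes in breadth-first order; the $i$-th node treated, of depth $d$, is split into two children if and only if $\sigma(1+d)^{-\phi}>\mathbf z_i$ and the resulting tree has size at most $t$. Then give each internal node a function drawn independently and uniformly from $\mathcal F$. This is the initial tree $T^0$. 2. *Metropolis–Hastings search.* Fix $a\in(0,\infty)^c$ and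 a probability distribution on the four moves: splitting a uniformly random leaf with a uniformly random function of $\mathcal F$; collapsing into a leaf a uniformly random internal node both of whose children are leaves; giving a uniformly random internal node a uniformly random function of $\mathcal F$; swapping the functions of a uniformly random pair consisting of an internal node and one of its internal children. A proposal draws a move and performs it (if it is impossible, the current tree is proposed). Let $k(T,T^*)$ be the probability of proposing $T^*$ at $T$. Let $\pi(T)=0$ if $T$ has size greater than $t$, and otherwise $$\pi(T)=p(y\mid X,T)=\prod_{\text{leaves } j \text{ of } T}\frac{\Gamma(\sum_i a_i)}{\prod_i\Gamma(a_i)}\cdot\frac{\prod_i\Gamma(n_{ji}+a_i)}{\Gamma(\sum_i n_{ji}+\sum_i a_i)},$$ where $n_{ji}$ is the number of data points with label $i$ at leaf $j$. From $T^s$, a proposal $T^*$ is accepted (that is, $T^{s+1}=T^*$) with probability $\min\{1,\ k(T^*,T^s)\pi(T^*)/(k(T^s,T^*)\pi(T^s))\}$; otherwise $T^{s+1}=T^s$. The output is $T^\omega$. The parameters $\sigma,\phi$ enter only through $T^0$. Let $\ell(\sigma,\phi;D)=\mathbb E\,L(T^\omega,D)$, the expectation being over all randomness of the algorithm. **Theorem.**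 There is an absolute constant $C>0$ such that for all data as above, every probability distribution $\mathcal D$ over datasets, all $\epsilon,\delta>0$ and every $$N\ \ge\ \frac{C}{\epsilon^2}\Big(\log t+\log\frac1\delta\Big),$$ with probability at least $1-\delta$ over independent $D_1,\dots,D_N\sim\mathcal D$ the following holds: for every $\eta\ge0$ and all $\hat\sigma,\hat\phi>0$ that minimize the empirical loss $\frac1N\sum_{i=1}^N\ell(\sigma,\phi;D_i)$ over $\sigma,\phi>0$ up to an additive error of at most $\eta$, $$\mathbb E_{D\sim\mathcal D}\,\ell(\hat\sigma,\hat\phi;D)\ \le\ \inf_{\sigma,\phi>0}\mathbb E_{D\sim\mathcal D}\,\ell(\sigma,\phi;D)+\epsilon+\eta .$$ In particular ($\eta=0$), exact empirical risk minimizers have expected loss at most $\epsilon$ larger than the best possible. -/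

import Mathlib

open MeasureTheory
open scoped ENNReal

noncomputable section

namespace BayesTree

/-! ### Datasets and decision trees -/

/-- A classification problem `(X, y)` with `n` labelled points and `c` classes. -/
abbrev Dataset (𝒳 : Type*) (n c : ℕ) : Type _ := (Fin n → 𝒳) × (Fin n → Fin c)

/-- A decision tree over the node function class `𝓕`: the internal nodes carry node functions,
`BinaryTree.nil` is a leaf. (Leaf predictions are computed from the dataset, see `predict`.) -/
abbrev DTree {𝒳 : Type*} (𝓕 : Finset (𝒳 → Bool)) : Type _ := BinaryTree 𝓕

/-- The size of a tree: its total number of nodes, internal nodes and leaves together. -/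
def size {α : Type*} (T : BinaryTree α) : ℕ := T.numNodes + T.numLeaves

/-- The root-to-leaf path of the leaf of `T` to which `x` is mapped
(`false` is the left branch, `true` the right branch). -/
def route {𝒳 : Type*} {𝓕 : Finset (𝒳 → Bool)} : DTree 𝓕 → 𝒳 → List Bool
  | .nil, _ => []
  | .node f l r, x => f.1 x :: (if f.1 x then route r x else route l x)

/-- The leaves of a tree, given by their root-to-leaf paths. -/
def leafPaths {α : Type*} : BinaryTree α → List (List Bool)
  | .nil => [[]]
  | .node _ l r => (leafPaths l).map (List.cons false) ++ (leafPaths r).map (List.cons true)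

/-- The number of points of `D` that are mapped to the leaf `v` of `T` and have label `i`. -/
def labelCount {𝒳 : Type*} {𝓕 : Finset (𝒳 → Bool)} {n c : ℕ} (D : Dataset 𝒳 n c)
    (T : DTree 𝓕) (v : List Bool) (i : Fin c) : ℕ :=
  (Finset.univ.filter fun k : Fin n => route T (D.1 k) = v ∧ D.2 k = i).card

/-- A rule by which a leaf predicts a (possibly random) label, given the label counts of the data
at the leaf. Majority vote with any tie-breaking and the Dirichlet posterior predictive
distribution `i ↦ (nᵢ + aᵢ) / (∑ j, (nⱼ + aⱼ))` are instances. -/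
abbrev LeafRule (c : ℕ) : Type := (Fin c → ℕ) → PMF (Fin c)

/-- The law of the label predicted at `x` by the tree `T` whose leaves are labelled by `D`. -/
def predict {𝒳 : Type*} {𝓕 : Finset (𝒳 → Bool)} {n c : ℕ} (κ : LeafRule c) (D : Dataset 𝒳 n c)
    (T : DTree 𝓕) (x : 𝒳) : PMF (Fin c) :=
  κ (labelCount D T (route T x))

/-- The expected fraction of incorrect predictions of `T` on `D`. -/
def loss {𝒳 : Type*} {𝓕 : Finset (𝒳 → Bool)} {n c : ℕ} (κ : LeafRule c) (D : Dataset 𝒳 n c)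
    (T : DTree 𝓕) : ℝ :=
  (∑ k : Fin n, (1 - (predict κ D T (D.1 k) (D.2 k)).toReal)) / n

/-! ### The prior -/

/-- The tree obtained by splitting the leaf at the path `v`. -/
def splitAt : List Bool → BinaryTree Unit → BinaryTree Unit
  | [], .nil => .node () .nil .nil
  | false :: v, .node u l r => .node u (splitAt v l) r
  | true :: v, .node u l r => .node u l (splitAt v r)
  | _, T => T

/-- The split probability `σ (1 + d)^(-φ)` of a node of depth `d`. -/
def pSplit (σ φ : ℝ) (d : ℕ) : ℝ := σ * (1 + (d : ℝ)) ^ (-φ)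

/-- Grow the shape of a tree. The first argument after `t σ φ` lists the remaining coins, the
second the nodes (given by their paths) that wait for their splitting decision, the third is the
current shape. The next node `v` uses the next coin `z`; it is split iff its split probability
exceeds `z` and the tree does not outgrow the size bound `t`. -/
def growShape (t : ℕ) (σ φ : ℝ) :
    List unitInterval → List (List Bool) → BinaryTree Unit → BinaryTree Unit
  | [], _, T => T
  | _ :: _, [], T => T
  | z :: zs, v :: q, T =>
    if (z : ℝ) < pSplit σ φ v.length ∧ size T + 2 ≤ t then
      growShape t σ φ zs (q ++ [v ++ [false], v ++ [true]]) (splitAt v T)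
    else growShape t σ φ zs q T

/-- The shape of the initial tree, as a function of the random coins `z ∈ [0,1]^(t-1)`. It starts
from a single node, and the nodes are treated in breadth-first order. -/
def initialShape (t : ℕ) (σ φ : ℝ) (z : Fin (t - 1) → unitInterval) : BinaryTree Unit :=
  growShape t σ φ (List.ofFn z) [[]] .nil

/-- The law of the tree obtained from a shape by choosing the node function of every internal node
independently and uniformly at random from `𝓕`. -/
def labelShape {𝒳 : Type*} (𝓕 : Finset (𝒳 → Bool)) [Nonempty 𝓕] : BinaryTree Unit → PMF (DTree 𝓕)
  | .nil => PMF.pure .nil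
  | .node _ l r =>
    (PMF.uniformOfFintype 𝓕).bind fun f =>
      (labelShape 𝓕 l).bind fun l' => (labelShape 𝓕 r).map fun r' => .node f l' r'

/-! ### Metropolis–Hastings search -/

/-- The kinds of proposals of the stochastic search. -/
inductive Move
  | grow | prune | change | swap

section Moves

variable {α : Type*}

/-- All trees that arise by splitting one leaf with the function `f` (one for every leaf). -/
def grows (f : α) : BinaryTree α → Multiset (BinaryTree α)
  | .nil => {.node f .nil .nil}
  | .node g l r => (grows f l).map (fun l' => .node g l' r) + (grows f r).map (fun r' => .node g l r')

/-- All trees that arise by collapsing into a leaf one internal node whose children are both leaves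
(one for every such node). -/
def prunes : BinaryTree α → Multiset (BinaryTree α)
  | .nil => 0
  | .node _ .nil .nil => {.nil}
  | .node g l r => (prunes l).map (fun l' => .node g l' r) + (prunes r).map (fun r' => .node g l r')

/-- All trees that arise by giving one internal node the function `f` (one for every such node). -/
def changes (f : α) : BinaryTree α → Multiset (BinaryTree α)
  | .nil => 0
  | .node g l r => {.node f l r} + (changes f l).map (fun l' => .node g l' r)
      + (changes f r).map (fun r' => .node g l r')

/-- Swap the functions of the root, which carries `g`, and of its left child. -/
def swapLeft (g : α) : BinaryTree α → BinaryTree α → Multiset (BinaryTree α)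
  | .nil, _ => 0
  | .node h a b, r => {.node h (.node g a b) r}

/-- Swap the functions of the root, which carries `g`, and of its right child. -/
def swapRight (g : α) : BinaryTree α → BinaryTree α → Multiset (BinaryTree α)
  | _, .nil => 0
  | l, .node h a b => {.node h l (.node g a b)}

/-- All trees that arise by swapping the functions of an internal node and one of its internal
children (one for every such pair). -/
def swaps : BinaryTree α → Multiset (BinaryTree α)
  | .nil => 0
  | .node g l r => swapLeft g l r + swapRight g l r + (swaps l).map (fun l' => .node g l' r)
      + (swaps r).map (fun r' => .node g l r')

/-- The equally likely results of a move of a given kind, counted with multiplicity: the node (or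
pair of nodes) and, if needed, the new node function are uniformly random. -/
def candidates [Fintype α] (T : BinaryTree α) : Move → Multiset (BinaryTree α)
  | .grow => (Finset.univ : Finset α).val.bind fun f => grows f T
  | .prune => prunes T
  | .change => (Finset.univ : Finset α).val.bind fun f => changes f T
  | .swap => swaps T

open Classical in
/-- The proposal kernel: draw the kind of the move from `w`, then one of its candidates uniformly
at random. If there is none, the proposal is the current tree. -/
def proposal [Fintype α] (w : PMF Move) (T : BinaryTree α) : PMF (BinaryTree α) :=
  w.bind fun m =>
    if h : candidates T m = 0 then PMF.pure T else PMF.ofMultiset (candidates T m) h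

end Moves

/-- The marginal likelihood `p(y | X, T)` of the labels under independent Dirichlet priors with
parameter `a` on the class probabilities at the leaves of `T`. -/
def marginalLikelihood {𝒳 : Type*} {𝓕 : Finset (𝒳 → Bool)} {n c : ℕ} (a : Fin c → ℝ)
    (D : Dataset 𝒳 n c) (T : DTree 𝓕) : ℝ :=
  ((leafPaths T).map fun v =>
    (Real.Gamma (∑ i, a i) / ∏ i, Real.Gamma (a i)) *
      ((∏ i, Real.Gamma (labelCount D T v i + a i)) /
        Real.Gamma ((∑ i, (labelCount D T v i : ℝ)) + ∑ i, a i))).prod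

/-- The unnormalized target of the search: `p(y | X, T)` on the trees of size at most `t`. -/
def target {𝒳 : Type*} {𝓕 : Finset (𝒳 → Bool)} {n c : ℕ} (t : ℕ) (a : Fin c → ℝ)
    (D : Dataset 𝒳 n c) (T : DTree 𝓕) : ℝ≥0∞ :=
  if size T ≤ t then ENNReal.ofReal (marginalLikelihood a D T) else 0

/-- The Metropolis–Hastings probability of accepting the proposal `T'` at `T`. -/
def acceptProb {𝒳 : Type*} {𝓕 : Finset (𝒳 → Bool)} {n c : ℕ} (t : ℕ) (a : Fin c → ℝ)
    (w : PMF Move) (D : Dataset 𝒳 n c) (T T' : DTree 𝓕) : ℝ≥0∞ :=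
  min 1 ((proposal w T' T * target t a D T') / (proposal w T T' * target t a D T))

/-- The law of a coin with success probability `q`. -/
def coin (q : ℝ≥0∞) (hq : q ≤ 1) : PMF Bool :=
  PMF.ofFintype (fun b => if b then q else 1 - q) (by simp [hq])

/-- One step of the search: move to the proposed tree if it is accepted, otherwise stay. -/
def mhStep {𝒳 : Type*} {𝓕 : Finset (𝒳 → Bool)} {n c : ℕ} (t : ℕ) (a : Fin c → ℝ)
    (w : PMF Move) (D : Dataset 𝒳 n c) (T : DTree 𝓕) : PMF (DTree 𝓕) :=
  (proposal w T).bind fun T' =>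
    (coin (acceptProb t a w D T T') (min_le_left _ _)).map fun b => if b then T' else T

/-- The law of the output `T^ω` of the algorithm on `D` (over the randomness in the choice of the
node functions and in the search), given the shape of the initial tree. -/
def outputLaw {𝒳 : Type*} (𝓕 : Finset (𝒳 → Bool)) [Nonempty 𝓕] {n c : ℕ} (t : ℕ)
    (a : Fin c → ℝ) (w : PMF Move) (ω : ℕ) (D : Dataset 𝒳 n c) (s : BinaryTree Unit) :
    PMF (DTree 𝓕) :=
  (fun μ : PMF (DTree 𝓕) => μ.bind (mhStep t a w D))^[ω] (labelShape 𝓕 s)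

/-! ### Losses of the parameters -/

/-- The expected loss on `D` of the algorithm with parameters `ρ = (σ, φ)`, over all of its
randomness: the uniform coins `z` and the remaining randomness. -/
def expLoss {𝒳 : Type*} (𝓕 : Finset (𝒳 → Bool)) [Nonempty 𝓕] {n c : ℕ} (t : ℕ) (a : Fin c → ℝ)
    (w : PMF Move) (κ : LeafRule c) (ω : ℕ) (ρ : ℝ × ℝ) (D : Dataset 𝒳 n c) : ℝ :=
  ∫ z : Fin (t - 1) → unitInterval,
    ∑' T : DTree 𝓕, (outputLaw 𝓕 t a w ω D (initialShape t ρ.1 ρ.2 z) T).toReal * loss κ D T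

/-- The average of the expected losses over a sample of datasets. -/
def empLoss {𝒳 : Type*} (𝓕 : Finset (𝒳 → Bool)) [Nonempty 𝓕] {n c : ℕ} (t : ℕ) (a : Fin c → ℝ)
    (w : PMF Move) (κ : LeafRule c) (ω : ℕ) {N : ℕ} (S : Fin N → Dataset 𝒳 n c) (ρ : ℝ × ℝ) : ℝ :=
  (∑ i, expLoss 𝓕 t a w κ ω ρ (S i)) / N

/-- The expected loss over the distribution `𝒟` of datasets. -/
def popLoss {𝒳 : Type*} [MeasurableSpace 𝒳] (𝓕 : Finset (𝒳 → Bool)) [Nonempty 𝓕] {n c : ℕ} (t : ℕ)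
    (a : Fin c → ℝ) (w : PMF Move) (κ : LeafRule c) (ω : ℕ) (𝒟 : Measure (Dataset 𝒳 n c))
    (ρ : ℝ × ℝ) : ℝ :=
  ∫ D, expLoss 𝓕 t a w κ ω ρ D ∂𝒟

/-- The admissible parameters: `σ > 0` and `φ > 0`. -/
def params : Set (ℝ × ℝ) := {ρ | 0 < ρ.1 ∧ 0 < ρ.2}

/-- `ρ` minimizes the average loss over the sample `S` up to an error of at most `η`; for `η = 0`
it is an output of empirical risk minimization. -/
def IsApproxERM {𝒳 : Type*} (𝓕 : Finset (𝒳 → Bool)) [Nonempty 𝓕] {n c : ℕ} (t : ℕ)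
    (a : Fin c → ℝ) (w : PMF Move) (κ : LeafRule c) (ω : ℕ) {N : ℕ} (S : Fin N → Dataset 𝒳 n c)
    (η : ℝ) (ρ : ℝ × ℝ) : Prop :=
  ρ ∈ params ∧ ∀ ρ' ∈ params, empLoss 𝓕 t a w κ ω S ρ ≤ empLoss 𝓕 t a w κ ω S ρ' + η

end BayesTree

end

noncomputable section

namespace BayesTree

/-! For fixed coins `z`, the parameters act only through the comparisons of the coins with the split
probabilities. After taking logarithms, each comparison is affine in `(φ, log σ)`, so the attainable
patterns are traces of half-planes; Sauer–Shelah leaves at most `t ^ 6` of them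
(`ncard_range_splitPattern_le`). The expected loss averages over `z`, and all `z` together may
realize far more patterns, so a union bound over patterns must be made inside the average. The
deviation of the averaged loss is the average over `z` of the deviations of the pattern losses.
Jensen's inequality for an exponential moves the average outside, the sum over the patterns possible
at `z` removes the parameters, and Hoeffding's lemma bounds each summand
(`measure_exists_deviation_le`). The algorithm sees a dataset only through finitely many feature
values, so datasets can be replaced by elements of a finite type, where measurability is automatic.
-/

/-! ### Uniform deviations of averaged losses -/

/-- One inequality of Tonelli's theorem, without measurability in the second variable. -/
lemma lintegral_lintegral_le_of_fintype {Θ Z : Type*} [Fintype Θ] [MeasurableSpace Θ]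
    [MeasurableSingletonClass Θ] [MeasurableSpace Z] (μ : Measure Θ) [IsFiniteMeasure μ]
    (ν : Measure Z) (U : Z → Θ → ℝ≥0∞) :
    ∫⁻ τ, ∫⁻ z, U z τ ∂ν ∂μ ≤ ∫⁻ z, ∫⁻ τ, U z τ ∂μ ∂ν := by
  -- The lower integral is superadditive even for nonmeasurable functions. This matters because the
  -- set of patterns attained at `z`, over uncountably many parameters, need not depend measurably
  -- on `z`.
  have superadd : ∀ (s : Finset Θ) (f : Θ → Z → ℝ≥0∞),
      ∑ x ∈ s, ∫⁻ z, f x z ∂ν ≤ ∫⁻ z, ∑ x ∈ s, f x z ∂ν := by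
    classical
    intro s f
    induction s using Finset.induction_on with
    | empty => simp
    | insert x s hx ih =>
      simp only [Finset.sum_insert hx]
      exact (add_le_add le_rfl ih).trans (le_lintegral_add _ _)
  simp only [lintegral_fintype]
  refine le_trans (Finset.sum_le_sum fun x _ => ?_) (superadd _ _)
  rw [lintegral_mul_const' _ _ (measure_ne_top μ _)]

/-- The deviation of the empirical mean of `h` over the sample `S` from its expectation. -/
def deviation {Θ : Type*} [MeasurableSpace Θ] (P : Measure Θ) {N : ℕ} (h : Θ → ℝ)
    (S : Fin N → Θ) : ℝ :=
  (∑ i, h (S i)) / N - ∫ θ, h θ ∂P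

/-- Hoeffding's lemma: each centred summand is sub-Gaussian with parameter `1/4`, their independent
sum with `N/4`, evaluated at `r / N`. -/
lemma lintegral_exp_deviation_le {Θ : Type*} [Finite Θ] [MeasurableSpace Θ]
    [MeasurableSingletonClass Θ] (P : Measure Θ) [IsProbabilityMeasure P] {N : ℕ} (hN : 0 < N)
    {h : Θ → ℝ} (hh : ∀ θ, h θ ∈ Set.Icc (0 : ℝ) 1) (r : ℝ) :
    ∫⁻ S, ENNReal.ofReal (Real.exp (r * deviation P h S)) ∂(Measure.pi fun _ : Fin N => P) ≤
      ENNReal.ofReal (Real.exp (r ^ 2 / (8 * N))) := by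
  have hN' : (0 : ℝ) < N := by exact_mod_cast hN
  have hm : Measurable h := measurable_of_finite h
  set c := ∫ θ, h θ ∂P with hc
  have hsub : ProbabilityTheory.HasSubgaussianMGF (fun θ => h θ - c) ((‖(1 : ℝ) - 0‖₊ / 2) ^ 2) P :=
    ProbabilityTheory.hasSubgaussianMGF_of_mem_Icc hm.aemeasurable (Filter.Eventually.of_forall hh)
  have hindep : ProbabilityTheory.iIndepFun (fun i (S : Fin N → Θ) => h (S i) - c)
      (Measure.pi fun _ : Fin N => P) :=
    ProbabilityTheory.iIndepFun_pi (X := fun _ θ => h θ - c)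
      (fun _ => (hm.sub_const c).aemeasurable)
  have hi : ∀ i ∈ (Finset.univ : Finset (Fin N)), ProbabilityTheory.HasSubgaussianMGF
      (fun S : Fin N → Θ => h (S i) - c) ((‖(1 : ℝ) - 0‖₊ / 2) ^ 2)
      (Measure.pi fun _ : Fin N => P) := by
    intro i _
    have hmp := measurePreserving_eval (fun _ : Fin N => P) i
    refine ProbabilityTheory.HasSubgaussianMGF.of_map (X := fun θ => h θ - c)
      (Y := Function.eval i) hmp.measurable.aemeasurable ?_
    rw [hmp.map_eq]
    exact hsub
  have hsum := ProbabilityTheory.HasSubgaussianMGF.sum_of_iIndepFun hindep hi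
  have hdev : ∀ S : Fin N → Θ, r * deviation P h S = r / N * ∑ i, (h (S i) - c) := by
    intro S
    simp only [deviation, Finset.sum_sub_distrib, Finset.sum_const, Finset.card_univ,
      Fintype.card_fin, nsmul_eq_mul, ← hc]
    field_simp
  simp only [hdev]
  rw [← ofReal_integral_eq_lintegral_ofReal (hsum.integrable_exp_mul _)
    (Filter.Eventually.of_forall fun _ => (Real.exp_pos _).le)]
  refine ENNReal.ofReal_le_ofReal ((hsum.mgf_le (r / N)).trans_eq ?_)
  congr 1
  simp
  field_simp
  norm_num [mul_comm]

/-- Uniform deviation bound for losses of the form `θ ↦ 𝔼 z, G (pat ρ z) θ` where, for each fixed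
`z`, the pattern `pat ρ z` takes at most `K` values. -/
theorem measure_exists_deviation_le {Θ Z R B : Type*} [Finite Θ] [MeasurableSpace Θ]
    [MeasurableSingletonClass Θ] (P : Measure Θ) [IsProbabilityMeasure P]
    [MeasurableSpace Z] (ν : Measure Z) [IsProbabilityMeasure ν]
    [Finite B] [MeasurableSpace B] [MeasurableSingletonClass B]
    (pat : R → Z → B) (hpat : ∀ ρ, Measurable (pat ρ))
    (G : B → Θ → ℝ) (hG : ∀ b θ, G b θ ∈ Set.Icc (0 : ℝ) 1)
    {K : ℕ} (hK : ∀ z, (Set.range fun ρ => pat ρ z).ncard ≤ K)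
    {N : ℕ} (hN : 0 < N) {ε : ℝ} (hε : 0 < ε) :
    (Measure.pi fun _ : Fin N => P)
        {S | ∃ ρ, ε ≤ |deviation P (fun θ => ∫ z, G (pat ρ z) θ ∂ν) S|} ≤
      ENNReal.ofReal (2 * K * Real.exp (-2 * N * ε ^ 2)) := by
  classical
  cases nonempty_fintype Θ
  cases nonempty_fintype B
  have hN' : (0 : ℝ) < N := by exact_mod_cast hN
  set μ := Measure.pi fun _ : Fin N => P
  -- The minimizer of `r ^ 2 / (8 * N) - r * ε`, with minimum `-2 * N * ε ^ 2`.
  set r : ℝ := 4 * N * ε with hr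
  let Φ : ℝ → ℝ := fun x => Real.exp (r * x) + Real.exp (-r * x)
  let vals : Z → Finset B := fun z => Finset.univ.filter fun b => ∃ ρ, pat ρ z = b
  let W : (Fin N → Θ) → ℝ≥0∞ := fun S =>
    ∫⁻ z, ∑ b ∈ vals z, ENNReal.ofReal (Φ (deviation P (G b) S)) ∂ν
  have hΦ0 : ∀ x, 0 ≤ Φ x := fun x => by positivity
  have hΦconv : ConvexOn ℝ Set.univ Φ := by
    have h : ∀ s : ℝ, ConvexOn ℝ Set.univ fun x : ℝ => Real.exp (s * x) := fun s =>
      convexOn_exp.comp_linearMap (LinearMap.mulLeft ℝ s)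
    exact (h r).add (h (-r))
  have hΦcont : Continuous Φ := by fun_prop
  have hint : ∀ (ρ : R) (g : B → ℝ), Integrable (fun z => g (pat ρ z)) ν := by
    intro ρ g
    have : Integrable g (ν.map (pat ρ)) :=
      haveI := Measure.isProbabilityMeasure_map (μ := ν) (hpat ρ).aemeasurable
      Integrable.of_finite
    exact this.comp_measurable (hpat ρ)
  have hdev : ∀ ρ (S : Fin N → Θ), deviation P (fun θ => ∫ z, G (pat ρ z) θ ∂ν) S =
      ∫ z, deviation P (G (pat ρ z)) S ∂ν := by
    intro ρ S
    have h1 : ∫ θ, ∫ z, G (pat ρ z) θ ∂ν ∂P = ∫ z, ∫ θ, G (pat ρ z) θ ∂P ∂ν := by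
      simp only [integral_fintype Integrable.of_finite]
      rw [integral_finsetSum _ fun θ _ => (hint ρ fun b => P.real {θ} • G b θ)]
      simp only [integral_smul]
    simp only [deviation]
    rw [integral_sub (hint ρ fun b => (∑ i, G b (S i)) / N) (hint ρ fun b => ∫ θ, G b θ ∂P), h1,
      integral_div, integral_finsetSum _ fun i _ => hint ρ fun b => G b (S i)]
  have hbad : ∀ S, (∃ ρ, ε ≤ |deviation P (fun θ => ∫ z, G (pat ρ z) θ ∂ν) S|) →
      ENNReal.ofReal (Real.exp (r * ε)) ≤ W S := by
    rintro S ⟨ρ, hρ⟩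
    rw [hdev] at hρ
    set x := ∫ z, deviation P (G (pat ρ z)) S ∂ν with hx
    have hexp : Real.exp (r * ε) ≤ Φ x := by
      have hr0 : 0 ≤ r := by positivity
      have h1 : Real.exp (r * ε) ≤ Real.exp (r * |x|) :=
        Real.exp_le_exp.2 (mul_le_mul_of_nonneg_left hρ hr0)
      rcases abs_choice x with h | h <;> rw [h] at h1
      · exact h1.trans (le_add_of_nonneg_right (Real.exp_pos _).le)
      · rw [mul_neg, ← neg_mul] at h1
        exact h1.trans (le_add_of_nonneg_left (Real.exp_pos _).le)
    -- After Jensen, `ρ` occurs only through a single term of the nonnegative sum over `vals z`; the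
    -- resulting bound `W S` does not depend on `ρ`.
    have hjensen : Φ x ≤ ∫ z, Φ (deviation P (G (pat ρ z)) S) ∂ν :=
      hΦconv.map_integral_le hΦcont.continuousOn isClosed_univ (by simp)
        (hint ρ fun b => deviation P (G b) S) (hint ρ fun b => Φ (deviation P (G b) S))
    refine (ENNReal.ofReal_le_ofReal (hexp.trans hjensen)).trans ?_
    rw [ofReal_integral_eq_lintegral_ofReal (hint ρ fun b => Φ (deviation P (G b) S))
      (Filter.Eventually.of_forall fun _ => hΦ0 _)]
    refine lintegral_mono fun z => ?_
    exact Finset.single_le_sum (f := fun b => ENNReal.ofReal (Φ (deviation P (G b) S)))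
      (fun _ _ => zero_le) (Finset.mem_filter.2 ⟨Finset.mem_univ _, ρ, rfl⟩)
  have hW : ∫⁻ S, W S ∂μ ≤ ENNReal.ofReal (2 * K * Real.exp (r ^ 2 / (8 * N))) := by
    -- With `z` outermost, only the at most `K` patterns possible at this `z` contribute.
    refine (lintegral_lintegral_le_of_fintype μ ν _).trans ?_
    have hterm : ∀ b, ∫⁻ S, ENNReal.ofReal (Φ (deviation P (G b) S)) ∂μ ≤
        ENNReal.ofReal (2 * Real.exp (r ^ 2 / (8 * N))) := by
      intro b
      have h1 := lintegral_exp_deviation_le P hN (hG b) r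
      have h2 := lintegral_exp_deviation_le P hN (hG b) (-r)
      rw [neg_sq] at h2
      simp only [Φ, ENNReal.ofReal_add (Real.exp_pos _).le (Real.exp_pos _).le]
      rw [lintegral_add_left (measurable_of_finite _), two_mul,
        ENNReal.ofReal_add (Real.exp_pos _).le (Real.exp_pos _).le]
      exact add_le_add h1 h2
    have hz : ∀ z, ∫⁻ S, ∑ b ∈ vals z, ENNReal.ofReal (Φ (deviation P (G b) S)) ∂μ ≤
        ENNReal.ofReal (2 * K * Real.exp (r ^ 2 / (8 * N))) := by
      intro z
      rw [lintegral_finsetSum _ fun _ _ => measurable_of_finite _]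
      refine (Finset.sum_le_card_nsmul _ _ _ fun b _ => hterm b).trans ?_
      have hcard : (vals z).card ≤ K := by
        refine le_trans (le_of_eq ?_) (hK z)
        rw [← Set.ncard_coe_finset]
        congr 1
        ext b
        simp [vals]
      rw [nsmul_eq_mul, mul_comm (2 : ℝ) K, mul_assoc, ENNReal.ofReal_mul (Nat.cast_nonneg K),
        ENNReal.ofReal_natCast]
      gcongr
    calc _ ≤ ∫⁻ _, ENNReal.ofReal (2 * K * Real.exp (r ^ 2 / (8 * N))) ∂ν := lintegral_mono hz
      _ = _ := by simp
  have hmarkov := mul_meas_ge_le_lintegral (μ := μ) (measurable_of_finite W)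
    (ENNReal.ofReal (Real.exp (r * ε)))
  have hpos : ENNReal.ofReal (Real.exp (r * ε)) ≠ 0 := by simp [Real.exp_pos]
  refine (measure_mono hbad).trans ?_
  refine ((ENNReal.le_div_iff_mul_le (Or.inl hpos) (Or.inl ENNReal.ofReal_ne_top)).2
    ((mul_comm _ _).trans_le (hmarkov.trans hW))).trans_eq ?_
  rw [← ENNReal.ofReal_div_of_pos (Real.exp_pos _), mul_div_assoc, ← Real.exp_sub]
  congr 3
  rw [hr]
  field_simp
  ring

/-! ### Counting the shapes of the initial trees -/

/-- A family of traces of half-planes has VC dimension at most three; points of `T`, which lie in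
every member of the family, are allowed in addition. -/
lemma vcDim_le_three_of_halfPlanes {α : Type*} [DecidableEq α] {𝒜 : Finset (Finset α)}
    (u v : α → ℝ) (T : Set α)
    (h𝒜 : ∀ A ∈ 𝒜, ∃ p q : ℝ, ∀ x, x ∈ A ↔ x ∈ T ∨ v x + p * u x < q) :
    𝒜.vcDim ≤ 3 := by
  refine Finset.sup_le fun s hs => ?_
  rw [Finset.mem_shatterer] at hs
  by_contra! hcard
  -- A point of `T` lies in every member, so the empty subset could not be cut out.
  have hT : ∀ x ∈ s, x ∉ T := by
    intro x hx hxT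
    obtain ⟨A, hA, hsA⟩ := hs (Finset.empty_subset s)
    obtain ⟨p, q, hpq⟩ := h𝒜 A hA
    have : x ∈ s ∩ A := Finset.mem_inter.2 ⟨hx, (hpq x).2 (Or.inl hxT)⟩
    simp [hsA] at this
  have hdep : ¬ LinearIndependent ℝ (fun x : s => (![1, u x, v x] : Fin 3 → ℝ)) := by
    intro h
    have := h.fintype_card_le_finrank
    simp at this
    omega
  rw [Fintype.not_linearIndependent_iff] at hdep
  obtain ⟨g, hg, i, hi⟩ := hdep
  -- Radon-type argument: a half-plane cutting out exactly `{g > 0}` makes every term `g x * (q - (v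
  -- x + p * u x))` nonnegative and the one at `i` positive, yet the affine dependence makes the sum
  -- vanish.
  have key : ∀ g : s → ℝ, ∑ x, g x = 0 → ∑ x, g x * u x = 0 → ∑ x, g x * v x = 0 →
      ∀ i, ¬ 0 < g i := by
    intro g h1 h2 h3 i hi
    obtain ⟨A, hA, hsA⟩ := hs
      (t := (Finset.univ.filter fun x : s => 0 < g x).map (Function.Embedding.subtype _))
      (by intro x hx; obtain ⟨y, -, rfl⟩ := Finset.mem_map.1 hx; exact y.2)
    obtain ⟨p, q, hpq⟩ := h𝒜 A hA
    have hmem : ∀ x : s, v x + p * u x < q ↔ 0 < g x := by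
      intro x
      have h := Finset.ext_iff.1 hsA x
      rw [Finset.mem_inter, hpq, or_iff_right (hT x x.2)] at h
      simpa using h
    have hsum : ∑ x : s, g x * (q - (v x + p * u x)) = 0 := by
      have : ∀ x : s, g x * (q - (v x + p * u x)) =
          q * g x - (g x * v x + p * (g x * u x)) := fun x => by ring
      simp only [this, Finset.sum_sub_distrib, Finset.sum_add_distrib, ← Finset.mul_sum, h1, h2, h3]
      ring
    have hpos : 0 < ∑ x : s, g x * (q - (v x + p * u x)) := by
      refine Finset.sum_pos' (fun x _ => ?_) ⟨i, Finset.mem_univ _, ?_⟩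
      · by_cases hx : 0 < g x
        · exact mul_nonneg hx.le (sub_nonneg.2 ((hmem x).2 hx).le)
        · exact mul_nonneg_of_nonpos_of_nonpos (not_lt.1 hx)
            (sub_nonpos.2 (not_lt.1 fun h => hx ((hmem x).1 h)))
      · exact mul_pos hi (sub_pos.2 ((hmem i).2 hi))
    exact hpos.ne' hsum
  have h1 : ∑ x, g x = 0 := by simpa using congrFun hg 0
  have h2 : ∑ x, g x * u x = 0 := by simpa using congrFun hg 1
  have h3 : ∑ x, g x * v x = 0 := by simpa using congrFun hg 2
  rcases lt_or_gt_of_ne hi with h | h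
  · exact key (fun x => -g x) (by rw [Finset.sum_neg_distrib, h1, neg_zero])
      (by simp only [neg_mul, Finset.sum_neg_distrib, h2, neg_zero])
      (by simp only [neg_mul, Finset.sum_neg_distrib, h3, neg_zero]) i (by simpa using h)
  · exact key g h1 h2 h3 i h

lemma card_le_of_vcDim_le_three {α : Type*} [Fintype α] [DecidableEq α] {𝒜 : Finset (Finset α)}
    (h : 𝒜.vcDim ≤ 3) : 𝒜.card ≤ (Fintype.card α + 1) ^ 3 := by
  set M := Fintype.card α
  calc 𝒜.card ≤ ∑ k ∈ Finset.Iic 𝒜.vcDim, M.choose k :=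
        (Finset.card_le_card_shatterer 𝒜).trans Finset.card_shatterer_le_sum_vcDim
    _ ≤ ∑ k ∈ Finset.range 4, M.choose k :=
        Finset.sum_le_sum_of_subset fun k hk => by
          simp only [Finset.mem_Iic, Finset.mem_range] at hk ⊢; omega
    _ ≤ ∑ k ∈ Finset.range 4, M ^ k := Finset.sum_le_sum fun k _ => Nat.choose_le_pow _ _
    _ ≤ (M + 1) ^ 3 := by simp only [Finset.sum_range_succ, Finset.sum_range_zero]; ring_nf; omega

/-- The outcomes of the comparisons of the coins `z` with the split probabilities. -/
def splitPattern {m : ℕ} (ρ : ℝ × ℝ) (z : Fin m → unitInterval) : Finset (Fin m × Fin m) :=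
  Finset.univ.filter fun p => (z p.1 : ℝ) < pSplit ρ.1 ρ.2 (p.2 : ℕ)

/-- Logarithms turn the comparison into a half-plane condition with slope `φ` and threshold `log σ`.
-/
lemma lt_pSplit_iff {x σ φ : ℝ} (hx : 0 < x) (hσ : 0 < σ) (d : ℕ) :
    x < pSplit σ φ d ↔ Real.log x + φ * Real.log (1 + d) < Real.log σ := by
  have hd : (0 : ℝ) < 1 + d := by positivity
  have hp : 0 < (1 + (d : ℝ)) ^ (-φ) := Real.rpow_pos_of_pos hd _
  rw [pSplit, ← Real.log_lt_log_iff hx (mul_pos hσ hp), Real.log_mul hσ.ne' hp.ne',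
    Real.log_rpow hd]
  constructor <;> intro h <;> linarith

lemma pSplit_pos {σ φ : ℝ} (hσ : 0 < σ) (d : ℕ) : 0 < pSplit σ φ d :=
  mul_pos hσ (Real.rpow_pos_of_pos (by positivity) _)

lemma ncard_range_splitPattern_le {m : ℕ} (z : Fin m → unitInterval) :
    (Set.range fun ρ : params => splitPattern ρ.1 z).ncard ≤ (m * m + 1) ^ 3 := by
  classical
  rw [Set.ncard_eq_toFinset_card']
  refine (card_le_of_vcDim_le_three (vcDim_le_three_of_halfPlanes
    (fun p => Real.log (1 + ((p.2 : ℕ) : ℝ))) (fun p => Real.log (z p.1)) {p | (z p.1 : ℝ) = 0}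
    fun A hA => ?_)).trans_eq (by simp)
  obtain ⟨ρ, rfl⟩ := Set.mem_toFinset.1 hA
  refine ⟨ρ.1.2, Real.log ρ.1.1, fun p => ?_⟩
  simp only [splitPattern, Finset.mem_filter, Finset.mem_univ, true_and, Set.mem_ofPred_eq]
  -- A zero coin always splits, but `Real.log 0 = 0` would hide this; such points form the
  -- exceptional set of the half-plane lemma.
  rcases (z p.1).2.1.eq_or_lt with h | h
  · simp only [← h, true_or, iff_true]
    exact pSplit_pos ρ.2.1 _
  · rw [lt_pSplit_iff h ρ.2.1, or_iff_right h.ne']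

lemma measurable_splitPattern {m : ℕ} [MeasurableSpace (Finset (Fin m × Fin m))] (ρ : ℝ × ℝ) :
    Measurable (splitPattern (m := m) ρ) := by
  refine measurable_to_countable' fun A => ?_
  have : splitPattern (m := m) ρ ⁻¹' {A} =
      ⋂ p : Fin m × Fin m, {z | (z p.1 : ℝ) < pSplit ρ.1 ρ.2 (p.2 : ℕ) ↔ p ∈ A} := by
    ext z
    simp [splitPattern, Finset.ext_iff]
  rw [this]
  refine MeasurableSet.iInter fun p => ?_
  have hlt : MeasurableSet {z : Fin m → unitInterval | (z p.1 : ℝ) < pSplit ρ.1 ρ.2 (p.2 : ℕ)} :=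
    measurableSet_lt (measurable_subtype_coe.comp (measurable_pi_apply p.1)) measurable_const
  exact hlt.iff (MeasurableSet.const _)

/-- Each treated node uses up a coin and its children are one level deeper, so depth plus remaining
coins never exceeds `M`. Hence only depths below `M` are ever compared. -/
lemma growShape_congr {t M : ℕ} {σ φ σ' φ' : ℝ} {zs zs' : List unitInterval}
    (h : List.Forall₂ (fun z z' : unitInterval => ∀ d < M,
      ((z : ℝ) < pSplit σ φ d ↔ (z' : ℝ) < pSplit σ' φ' d)) zs zs') :
    ∀ (q : List (List Bool)) (T : BinaryTree Unit), (∀ v ∈ q, v.length + zs.length ≤ M) →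
      growShape t σ φ zs q T = growShape t σ' φ' zs' q T := by
  induction h with
  | nil => intro q T _; simp [growShape]
  | @cons z z' zs zs' hz _ ih =>
    intro q T hq
    cases q with
    | nil => simp [growShape]
    | cons v q =>
      have hv := hq v (by simp)
      have hq' : ∀ v ∈ q, v.length + zs.length + 1 ≤ M := fun v' hv' => by
        simpa [add_assoc] using hq v' (by simp [hv'])
      rw [List.length_cons] at hv
      simp only [growShape, hz v.length (by omega)]
      split_ifs
      · refine ih _ _ fun v' hv' => ?_
        simp only [List.mem_append, List.mem_cons, List.not_mem_nil, or_false] at hv'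
        rcases hv' with hv' | rfl | rfl
        · have := hq' v' hv'; omega
        · simp only [List.length_append, List.length_cons, List.length_nil]; omega
        · simp only [List.length_append, List.length_cons, List.length_nil]; omega
      · exact ih _ _ fun v' hv' => by have := hq' v' hv'; omega

lemma initialShape_congr {t : ℕ} {ρ ρ' : ℝ × ℝ} {z z' : Fin (t - 1) → unitInterval}
    (h : splitPattern ρ z = splitPattern ρ' z') :
    initialShape t ρ.1 ρ.2 z = initialShape t ρ'.1 ρ'.2 z' := by
  refine growShape_congr (M := t - 1) ?_ _ _ (by simp)
  rw [List.forall₂_iff_get]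
  refine ⟨by simp, fun i hi _ d hd => ?_⟩
  rw [List.length_ofFn] at hi
  simpa [splitPattern] using Finset.ext_iff.1 h (⟨i, hi⟩, ⟨d, hd⟩)

/-! ### Dependence of the loss on the dataset -/

section Features

variable {𝒳 : Type*} {𝓕 : Finset (𝒳 → Bool)} {n c : ℕ}

/-- The part of a dataset that the algorithm uses: the values of the node functions at the points,
and the labels. -/
def features (𝓕 : Finset (𝒳 → Bool)) (D : Dataset 𝒳 n c) :
    (𝓕 → Fin n → Bool) × (Fin n → Fin c) :=
  (fun f k => f.1 (D.1 k), D.2)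

lemma measurable_features [MeasurableSpace 𝒳] (h𝓕 : ∀ f ∈ 𝓕, Measurable f) :
    Measurable (features (n := n) (c := c) 𝓕) := by
  refine Measurable.prodMk (measurable_pi_lambda _ fun f => measurable_pi_lambda _ fun k => ?_)
    measurable_snd
  exact (h𝓕 f.1 f.2).comp ((measurable_pi_apply k).comp measurable_fst)

lemma route_eq_of_features_eq {D D' : Dataset 𝒳 n c} (h : features 𝓕 D = features 𝓕 D')
    (T : DTree 𝓕) (k : Fin n) : route T (D.1 k) = route T (D'.1 k) := by
  induction T with
  | nil => rfl
  | node f l r ihl ihr =>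
    have hf : f.1 (D.1 k) = f.1 (D'.1 k) := congrFun (congrFun (Prod.ext_iff.1 h).1 f) k
    simp only [route, hf, ihl, ihr]

lemma labelCount_eq_of_features_eq {D D' : Dataset 𝒳 n c} (h : features 𝓕 D = features 𝓕 D') :
    labelCount (𝓕 := 𝓕) D = labelCount D' := by
  have h2 : D.2 = D'.2 := (Prod.ext_iff.1 h).2
  funext T v i
  simp only [labelCount, route_eq_of_features_eq h, h2]

lemma loss_eq_of_features_eq (κ : LeafRule c) {D D' : Dataset 𝒳 n c}
    (h : features 𝓕 D = features 𝓕 D') : loss (𝓕 := 𝓕) κ D = loss κ D' := by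
  have h2 : D.2 = D'.2 := (Prod.ext_iff.1 h).2
  funext T
  simp only [loss, predict, labelCount_eq_of_features_eq h, route_eq_of_features_eq h, h2]

/-- Proposals ignore the data, and the target sees it only through label counts. -/
lemma mhStep_eq_of_features_eq [Nonempty 𝓕] (t : ℕ) (a : Fin c → ℝ) (w : PMF Move)
    {D D' : Dataset 𝒳 n c} (h : features 𝓕 D = features 𝓕 D') :
    mhStep (𝓕 := 𝓕) t a w D = mhStep t a w D' := by
  funext T
  simp only [mhStep, acceptProb, target, marginalLikelihood, labelCount_eq_of_features_eq h]

lemma loss_mem_Icc (κ : LeafRule c) (D : Dataset 𝒳 n c) (T : DTree 𝓕) :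
    loss κ D T ∈ Set.Icc (0 : ℝ) 1 := by
  have h0 : ∀ k, 0 ≤ 1 - (predict κ D T (D.1 k) (D.2 k)).toReal := fun k =>
    sub_nonneg.2 (ENNReal.toReal_le_of_le_ofReal zero_le_one
      (by simpa using PMF.coe_le_one _ _))
  refine ⟨div_nonneg (Finset.sum_nonneg fun k _ => h0 k) (Nat.cast_nonneg n),
    div_le_one_of_le₀ ?_ (Nat.cast_nonneg n)⟩
  refine (Finset.sum_le_card_nsmul _ _ 1 fun k _ =>
    sub_le_self _ ENNReal.toReal_nonneg).trans_eq ?_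
  simp

/-- The expected loss on `D`, given the shape `s` of the initial tree. -/
def shapeLoss (𝓕 : Finset (𝒳 → Bool)) [Nonempty 𝓕] (t : ℕ) (a : Fin c → ℝ) (w : PMF Move)
    (κ : LeafRule c) (ω : ℕ) (s : BinaryTree Unit) (D : Dataset 𝒳 n c) : ℝ :=
  ∑' T : DTree 𝓕, (outputLaw 𝓕 t a w ω D s T).toReal * loss κ D T

variable [Nonempty 𝓕] (t : ℕ) (a : Fin c → ℝ) (w : PMF Move) (κ : LeafRule c) (ω : ℕ)

lemma shapeLoss_eq_of_features_eq (s : BinaryTree Unit)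
    {D D' : Dataset 𝒳 n c} (h : features 𝓕 D = features 𝓕 D') :
    shapeLoss 𝓕 t a w κ ω s D = shapeLoss 𝓕 t a w κ ω s D' := by
  simp only [shapeLoss, outputLaw, mhStep_eq_of_features_eq t a w h, loss_eq_of_features_eq κ h]

lemma shapeLoss_mem_Icc (s : BinaryTree Unit) (D : Dataset 𝒳 n c) :
    shapeLoss 𝓕 t a w κ ω s D ∈ Set.Icc (0 : ℝ) 1 := by
  set p := outputLaw 𝓕 t a w ω D s
  have hp : Summable fun T => (p T).toReal := ENNReal.summable_toReal p.tsum_coe_ne_top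
  have h0 : ∀ T, 0 ≤ (p T).toReal * loss κ D T := fun T =>
    mul_nonneg ENNReal.toReal_nonneg (loss_mem_Icc κ D T).1
  have h1 : ∀ T, (p T).toReal * loss κ D T ≤ (p T).toReal := fun T =>
    mul_le_of_le_one_right ENNReal.toReal_nonneg (loss_mem_Icc κ D T).2
  refine ⟨tsum_nonneg h0, ((Summable.of_nonneg_of_le h0 h1 hp).tsum_le_tsum h1 hp).trans_eq ?_⟩
  rw [← ENNReal.tsum_toReal_eq fun T => p.apply_ne_top T, p.tsum_coe, ENNReal.toReal_one]

/-- The initial shape with a given pattern of comparisons. -/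
def shapeOfPattern (t : ℕ) : Finset (Fin (t - 1) × Fin (t - 1)) → BinaryTree Unit :=
  Function.extend (fun x : (ℝ × ℝ) × (Fin (t - 1) → unitInterval) => splitPattern x.1 x.2)
    (fun x => initialShape t x.1.1 x.1.2 x.2) fun _ => .nil

lemma shapeOfPattern_splitPattern (ρ : ℝ × ℝ) (z : Fin (t - 1) → unitInterval) :
    shapeOfPattern t (splitPattern ρ z) = initialShape t ρ.1 ρ.2 z :=
  Function.FactorsThrough.extend_apply
    (f := fun x : (ℝ × ℝ) × (Fin (t - 1) → unitInterval) => splitPattern x.1 x.2)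
    (g := fun x => initialShape t x.1.1 x.1.2 x.2)
    (fun _ _ h => initialShape_congr h) _ (ρ, z)

/-- The expected loss on a dataset with features `θ`, given the pattern `A` of comparisons. -/
def patternLoss (𝓕 : Finset (𝒳 → Bool)) [Nonempty 𝓕] (t : ℕ) (a : Fin c → ℝ) (w : PMF Move)
    (κ : LeafRule c) (ω : ℕ) (A : Finset (Fin (t - 1) × Fin (t - 1))) :
    (𝓕 → Fin n → Bool) × (Fin n → Fin c) → ℝ :=
  Function.extend (features 𝓕) (shapeLoss 𝓕 t a w κ ω (shapeOfPattern t A)) 0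

lemma patternLoss_mem_Icc (A : Finset (Fin (t - 1) × Fin (t - 1)))
    (θ : (𝓕 → Fin n → Bool) × (Fin n → Fin c)) :
    patternLoss 𝓕 t a w κ ω A θ ∈ Set.Icc (0 : ℝ) 1 := by
  classical
  rw [patternLoss, Function.extend_def]
  split_ifs
  · exact shapeLoss_mem_Icc t a w κ ω _ _
  -- Feature values realized by no dataset receive the default loss `0`.
  · simp

/-- This is the form required by `measure_exists_deviation_le`, with finite types of patterns and of
features. -/
lemma expLoss_eq_integral_patternLoss (ρ : ℝ × ℝ) (D : Dataset 𝒳 n c) :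
    expLoss 𝓕 t a w κ ω ρ D =
      ∫ z : Fin (t - 1) → unitInterval,
        patternLoss 𝓕 t a w κ ω (splitPattern ρ z) (features 𝓕 D) := by
  refine integral_congr_ae (Filter.Eventually.of_forall fun z => ?_)
  dsimp only
  rw [patternLoss, Function.FactorsThrough.extend_apply
    (fun _ _ h => shapeLoss_eq_of_features_eq t a w κ ω _ h), shapeOfPattern_splitPattern]
  rfl

end Features

/-! ### Empirical risk minimization -/

section ERM

variable {𝒳 : Type*} [MeasurableSpace 𝒳] {𝓕 : Finset (𝒳 → Bool)} [Nonempty 𝓕] {n c : ℕ}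
  (a : Fin c → ℝ) (w : PMF Move) (κ : LeafRule c) (ω : ℕ) (𝒟 : Measure (Dataset 𝒳 n c))

/-- There are no coins when `t = 1`. This case is treated apart because the factor `2` of the tail
bound is later absorbed using `2 ≤ t`. -/
lemma popLoss_eq_popLoss_of_bound_one (ρ ρ' : ℝ × ℝ) :
    popLoss 𝓕 1 a w κ ω 𝒟 ρ = popLoss 𝓕 1 a w κ ω 𝒟 ρ' := by
  have h : ∀ (ρ : ℝ × ℝ) (z : Fin (1 - 1) → unitInterval), initialShape 1 ρ.1 ρ.2 z = .nil :=
    fun ρ z => by simp [initialShape, growShape]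
  simp only [popLoss, expLoss, h]

lemma empLoss_sub_popLoss_eq_deviation (h𝓕 : ∀ f ∈ 𝓕, Measurable f) (t : ℕ) {N : ℕ}
    (S : Fin N → Dataset 𝒳 n c) (ρ : ℝ × ℝ) :
    empLoss 𝓕 t a w κ ω S ρ - popLoss 𝓕 t a w κ ω 𝒟 ρ =
      deviation (𝒟.map (features 𝓕))
        (fun θ => ∫ z, patternLoss 𝓕 t a w κ ω (splitPattern ρ z) θ)
        (fun i => features 𝓕 (S i)) := by
  simp only [empLoss, popLoss, deviation, expLoss_eq_integral_patternLoss]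
  rw [integral_map (measurable_features h𝓕).aemeasurable
    (measurable_of_finite _).aestronglyMeasurable]

/-- Uniform convergence of the empirical losses of all admissible parameters. -/
lemma measure_forall_abs_empLoss_sub_popLoss_lt (h𝓕 : ∀ f ∈ 𝓕, Measurable f) {t : ℕ} (ht : 1 ≤ t)
    [IsProbabilityMeasure 𝒟] {N : ℕ} (hN : 0 < N) {ε : ℝ} (hε : 0 < ε) :
    1 - 2 * (t : ℝ) ^ 6 * Real.exp (-2 * N * ε ^ 2) ≤
      (Measure.pi fun _ : Fin N => 𝒟).real
        {S | ∀ ρ ∈ params, |empLoss 𝓕 t a w κ ω S ρ - popLoss 𝓕 t a w κ ω 𝒟 ρ| < ε} := by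
  have hθ := measurable_features (n := n) (c := c) h𝓕
  let _ : MeasurableSpace (Finset (Fin (t - 1) × Fin (t - 1))) := ⊤
  have : IsProbabilityMeasure (𝒟.map (features 𝓕)) :=
    Measure.isProbabilityMeasure_map hθ.aemeasurable
  have hK : ∀ z : Fin (t - 1) → unitInterval,
      (Set.range fun ρ : params => splitPattern ρ.1 z).ncard ≤ t ^ 6 := by
    intro z
    refine (ncard_range_splitPattern_le z).trans ?_
    obtain ⟨m, rfl⟩ : ∃ m, t = m + 1 := ⟨t - 1, by omega⟩
    rw [show (m + 1) ^ 6 = ((m + 1) ^ 2) ^ 3 by ring]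
    refine Nat.pow_le_pow_left ?_ 3
    rw [Nat.add_sub_cancel]
    nlinarith
  have hdev := measure_exists_deviation_le (𝒟.map (features 𝓕)) volume
    (fun ρ : params => splitPattern (m := t - 1) ρ.1) (fun ρ => measurable_splitPattern ρ.1)
    (patternLoss 𝓕 t a w κ ω) (patternLoss_mem_Icc t a w κ ω) hK hN hε
  set bad : Set (Fin N → (𝓕 → Fin n → Bool) × (Fin n → Fin c)) :=
    {S | ∃ ρ : params, ε ≤ |deviation (𝒟.map (features 𝓕))
      (fun θ => ∫ z, patternLoss 𝓕 t a w κ ω (splitPattern ρ.1 z) θ) S|}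
  let Ψ : (Fin N → Dataset 𝒳 n c) → Fin N → (𝓕 → Fin n → Bool) × (Fin n → Fin c) :=
    fun S i => features 𝓕 (S i)
  have hΨ : Measurable Ψ := measurable_pi_lambda _ fun i => hθ.comp (measurable_pi_apply i)
  have hbad : MeasurableSet bad := bad.toFinite.measurableSet
  -- The product of the feature laws is the image of the product measure under `Ψ`, so the bound
  -- pulls back to samples of datasets.
  rw [← Measure.pi_map_pi fun _ => hθ.aemeasurable] at hdev
  change Measure.map Ψ _ bad ≤ _ at hdev
  rw [Measure.map_apply hΨ hbad] at hdev
  have hreal : (Measure.pi fun _ : Fin N => 𝒟).real (Ψ ⁻¹' bad) ≤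
      2 * (t : ℝ) ^ 6 * Real.exp (-2 * N * ε ^ 2) := by
    refine ENNReal.toReal_le_of_le_ofReal (by positivity) (hdev.trans_eq ?_)
    push_cast
    rfl
  refine (sub_le_sub_left hreal 1).trans ?_
  rw [← probReal_compl_eq_one_sub (hΨ hbad)]
  refine measureReal_mono (fun S hS ρ hρ => ?_)
  rw [empLoss_sub_popLoss_eq_deviation a w κ ω 𝒟 h𝓕]
  by_contra! h
  exact hS ⟨⟨ρ, hρ⟩, h⟩

end ERM

end BayesTree

end

theorem mainTheorem7 :
    ∃ C : ℝ, 0 < C ∧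
      ∀ (𝒳 : Type*) [MeasurableSpace 𝒳] (𝓕 : Finset (𝒳 → Bool)) [Nonempty 𝓕]
        (_ : ∀ f ∈ 𝓕, Measurable f) (n c t : ℕ) (_ : 1 ≤ t)
        (a : Fin c → ℝ) (_ : ∀ i, 0 < a i) (w : PMF BayesTree.Move)
        (κ : BayesTree.LeafRule c) (ω : ℕ)
        (𝒟 : MeasureTheory.Measure (BayesTree.Dataset 𝒳 n c))
        [MeasureTheory.IsProbabilityMeasure 𝒟]
        (ε δ : ℝ) (_ : 0 < ε) (_ : 0 < δ) (N : ℕ)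
        (_ : C / ε ^ 2 * (Real.log t + Real.log (1 / δ)) ≤ N),
        1 - δ ≤ (MeasureTheory.Measure.pi fun _ : Fin N => 𝒟).real
          {S | ∀ η : ℝ, 0 ≤ η → ∀ ρ : ℝ × ℝ, BayesTree.IsApproxERM 𝓕 t a w κ ω S η ρ →
            ∀ ρ' ∈ BayesTree.params,
              BayesTree.popLoss 𝓕 t a w κ ω 𝒟 ρ ≤
                BayesTree.popLoss 𝓕 t a w κ ω 𝒟 ρ' + ε + η} := by
  -- `14 = 2 * 7`: deviations of `ε / 2` give the exponent `-N * ε ^ 2 / 2`, and `2 * t ^ 6 ≤ t ^ 7`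
  -- has to be compensated.
  refine ⟨14, by norm_num, ?_⟩
  intro 𝒳 _ 𝓕 _ h𝓕 n c t ht a _ w κ ω 𝒟 _ ε δ hε hδ N hN
  rcases le_or_gt 1 δ with hδ1 | hδ1
  · exact (sub_nonpos.2 hδ1).trans measureReal_nonneg
  rcases ht.eq_or_lt with rfl | ht2
  · refine le_trans ?_ (measureReal_mono (s₁ := Set.univ) fun S _ η hη ρ _ ρ' _ => ?_)
    · rw [probReal_univ]
      linarith
    · rw [BayesTree.popLoss_eq_popLoss_of_bound_one a w κ ω 𝒟 ρ ρ']
      linarith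
  have ht0 : (0 : ℝ) < t := by exact_mod_cast ht
  have htR : (2 : ℝ) ≤ t := by exact_mod_cast ht2
  have hlogt : 0 < Real.log t := Real.log_pos (by linarith)
  have hlogδ : Real.log δ < 0 := Real.log_neg hδ hδ1
  rw [one_div, Real.log_inv] at hN
  have hN0 : 0 < N := by
    have : 0 < 14 / ε ^ 2 * (Real.log t + -Real.log δ) :=
      mul_pos (by positivity) (by linarith)
    exact_mod_cast this.trans_le hN
  have hN' : 14 * (Real.log t - Real.log δ) ≤ N * ε ^ 2 := by
    rw [div_mul_eq_mul_div, div_le_iff₀ (by positivity)] at hN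
    linarith
  have hbound : 2 * (t : ℝ) ^ 6 * Real.exp (-2 * N * (ε / 2) ^ 2) ≤ δ := by
    calc 2 * (t : ℝ) ^ 6 * Real.exp (-2 * N * (ε / 2) ^ 2)
        ≤ (t : ℝ) ^ 7 * Real.exp (Real.log δ - 7 * Real.log t) := by
          refine mul_le_mul ?_ (Real.exp_le_exp.2 ?_) (Real.exp_pos _).le (by positivity)
          · rw [pow_succ' (t : ℝ) 6]
            exact mul_le_mul_of_nonneg_right htR (by positivity)
          -- The sample size even yields `7 * log δ`, which is at most `log δ` since `δ < 1`.
          · nlinarith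
      _ = δ := by
          have h7 : Real.exp (7 * Real.log t) = (t : ℝ) ^ 7 := by
            rw [show (7 : ℝ) = (7 : ℕ) by norm_num, Real.exp_nat_mul, Real.exp_log ht0]
          rw [Real.exp_sub, Real.exp_log hδ, h7]
          field_simp
  -- On the good event, both parameters have empirical and population losses within `ε / 2`;
  -- near-minimality of `ρ` adds `η`.
  refine (sub_le_sub_left hbound 1).trans
    ((BayesTree.measure_forall_abs_empLoss_sub_popLoss_lt a w κ ω 𝒟 h𝓕 ht hN0
      (half_pos hε)).trans (measureReal_mono fun S hS η _ ρ hρ ρ' hρ' => ?_))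
  have h1 := abs_lt.1 (hS ρ hρ.1)
  have h2 := abs_lt.1 (hS ρ' hρ')
  have h3 := hρ.2 ρ' hρ'
  linarith
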